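/- Let $\phi$ be Euler's totient function, $\sigma(n)=\sum_{d\mid n} d$ the sum-of-divisors function, and $\lambda$ Carmichael's function, i.e. $\lambda(n)$ is the exponent of the group $(\mathbb{Z}/n\mathbb{Z})^{\times}$. Write $\log x := \max\{1,\ln x\}$, where $\ln$ is the natural logarithm. A set $E$ of positive integers is called thin if there are $\theta>0$ and $x_0>0$ such that $$\#\big(E\cap[1,x]\big) < \frac{x}{\exp\big((\log x)^{\theta}\big)}\qquad\text{for all real } x>x_0 .$$ Let $j\ge 1$ and suppose that $f = f_1\circ f_2\circ\cdots\circ f_j$, where each $f_i\in\{\phi,\sigma,\lambda\}$. Then the set of positive integers $n$ with $$f(n) < n^{1/2^{j}}$$ is thin. -/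

import Mathlib

/-- The three basic arithmetic functions: Euler's totient `φ`, the sum-of-divisors function `σ`,
and Carmichael's function `λ` (the exponent of the group `(ℤ/nℤ)ˣ` for `n ≥ 1`). -/
def basicFunctions : Set (ℕ → ℕ) :=
  {Nat.totient,
   fun n => ArithmeticFunction.sigma 1 n,
   fun n => ArithmeticFunction.carmichael n}

/-- The composition `f₁ ∘ f₂ ∘ ⋯ ∘ fⱼ` of the list `[f₁, f₂, …, fⱼ]`. -/
def composition (L : List (ℕ → ℕ)) : ℕ → ℕ :=
  L.foldr (fun g h => g ∘ h) id

/-- The function `max {1, ln x}`. -/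
noncomputable def truncLog (x : ℝ) : ℝ := max 1 (Real.log x)

/-- A set `E` of positive integers is thin if there are `θ > 0` and `x₀ > 0` such that
`#(E ∩ [1, x]) < x / exp ((log x) ^ θ)`, with `log x = max {1, ln x}`, for all real `x > x₀`. -/
def IsThin (E : Set ℕ) : Prop :=
  ∃ θ : ℝ, 0 < θ ∧ ∃ x₀ : ℝ, 0 < x₀ ∧ ∀ x : ℝ, x₀ < x →
    (({n : ℕ | n ∈ E ∧ 1 ≤ n ∧ (n : ℝ) ≤ x}.ncard : ℕ) : ℝ) < x / Real.exp (truncLog x ^ θ)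

open Finset Filter
open scoped Pointwise

/-! Each basic `f` has only small fibres once a thin set of arguments is discarded. Since `∑ τ(m)/m`
over `m ≤ N` is at most `(1 + log N)^2`, few `n ≤ N` have `τ(n) > 2^K`, and few have an exact prime
power divisor `p^a` whose local factor `g p a` has more than `2^K` divisors. For the other `n`,
`ω(n) ≤ K` and `τ(f n) ≤ 2^(K^2)`. Each `p^a` exactly dividing `n` is determined by `a` and the
divisor `h p a` of `f n`, so a value has at most `(log₂ N · 2^(K^2) + 1)^K` such preimages
(`PrimePowerControlled.card_preimage_le`).

With `K` a small power of `log x`, preimages of thin sets are thin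
(`PrimePowerControlled.isThin_preimage`). Applied to the interval up to `√x`, the same count shows
that `f n < √n` is rare (`PrimePowerControlled.isThin_lt_sqrt`). Off a thin set each function in the
composition therefore at worst halves the exponent. -/

/-! ### Divisor counts on average -/

theorem card_divisors_mul_le (a b : ℕ) :
    #(a * b).divisors ≤ #a.divisors * #b.divisors := by
  rw [Nat.divisors_mul]
  exact Finset.card_mul_le

theorem card_divisors_prod_le {ι : Type*} (s : Finset ι) (u : ι → ℕ) :
    #(∏ i ∈ s, u i).divisors ≤ ∏ i ∈ s, #(u i).divisors := by
  classical
  induction s using Finset.induction_on with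
  | empty => simp
  | insert i s hi ih =>
    rw [prod_insert hi, prod_insert hi]
    exact (card_divisors_mul_le _ _).trans (Nat.mul_le_mul_left _ ih)

theorem two_pow_card_primeFactors_le_card_divisors {n : ℕ} (hn : n ≠ 0) :
    2 ^ #n.primeFactors ≤ #n.divisors := by
  rw [Nat.card_divisors hn, ← prod_const]
  refine prod_le_prod' fun p hp => ?_
  have := (Nat.prime_of_mem_primeFactors hp).factorization_pos_of_dvd hn
    (Nat.dvd_of_mem_primeFactors hp)
  omega

/-- Writing `τ(m)/m` as the sum of `1/(ab)` over `ab = m` produces some of the terms of the expanded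
square. -/
theorem sum_card_divisors_div_le (N : ℕ) :
    ∑ m ∈ Ioc 0 N, (#m.divisors : ℝ) / m ≤ (∑ m ∈ Ioc 0 N, (1 : ℝ) / m) ^ 2 := by
  have h : ∀ m ∈ Ioc 0 N, (#m.divisors : ℝ) / m ≤
      ∑ q ∈ (Ioc 0 N ×ˢ Ioc 0 N) with q.1 * q.2 = m, (1 : ℝ) / q.1 * (1 / q.2) := by
    intro m hm
    rw [mem_Ioc] at hm
    have : (#m.divisors : ℝ) / m = ∑ q ∈ m.divisorsAntidiagonal, (1 : ℝ) / q.1 * (1 / q.2) := by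
      rw [sum_congr rfl (g := fun _ => (1 : ℝ) / m), sum_const, ← Nat.map_div_right_divisors,
        card_map, nsmul_eq_mul, mul_one_div]
      intro q hq
      rw [Nat.mem_divisorsAntidiagonal] at hq
      rw [one_div_mul_one_div, ← hq.1, Nat.cast_mul]
    rw [this]
    refine sum_le_sum_of_subset_of_nonneg (fun q hq => ?_) fun _ _ _ => by positivity
    have hq' := Nat.mem_divisorsAntidiagonal.1 hq
    have h1 := Nat.le_of_dvd hm.1 (Dvd.intro _ hq'.1)
    have h2 := Nat.le_of_dvd hm.1 (Dvd.intro_left _ hq'.1)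
    have h3 : q.1 ≠ 0 := by rintro h; rw [h] at hq'; omega
    have h4 : q.2 ≠ 0 := by rintro h; rw [h] at hq'; omega
    simp only [mem_filter, mem_product, mem_Ioc]
    omega
  refine (sum_le_sum h).trans ?_
  rw [sq, sum_mul_sum, ← sum_product']
  calc _ = ∑ m ∈ Ioc 0 N, ∑ q ∈ ((Ioc 0 N ×ˢ Ioc 0 N).filter fun q => q.1 * q.2 ∈ Ioc 0 N)
        with q.1 * q.2 = m, (1 : ℝ) / q.1 * (1 / q.2) := by
        refine sum_congr rfl fun m hm => sum_congr ?_ fun _ _ => rfl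
        ext q
        simp only [mem_filter]
        constructor
        · rintro ⟨h1, rfl⟩; exact ⟨⟨h1, hm⟩, rfl⟩
        · rintro ⟨⟨h1, -⟩, h2⟩; exact ⟨h1, h2⟩
    _ = ∑ q ∈ (Ioc 0 N ×ˢ Ioc 0 N).filter (fun q => q.1 * q.2 ∈ Ioc 0 N),
        (1 : ℝ) / q.1 * (1 / q.2) :=
        sum_fiberwise_of_maps_to (fun q hq => (mem_filter.1 hq).2) _
    _ ≤ _ := sum_le_sum_of_subset_of_nonneg (filter_subset _ _) fun _ _ _ => by positivity

/-- Markov's inequality for `τ` with weights `1/m`. -/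
theorem sum_one_div_of_card_divisors_gt_le (N K : ℕ) :
    ∑ m ∈ Ioc 0 N with 2 ^ K < #m.divisors, (1 : ℝ) / m ≤
      (∑ m ∈ Ioc 0 N, (1 : ℝ) / m) ^ 2 / 2 ^ K := by
  rw [le_div_iff₀ (by positivity), sum_mul]
  refine le_trans (sum_le_sum fun m hm => ?_) ((sum_le_sum_of_subset_of_nonneg
    (filter_subset _ _) fun _ _ _ => by positivity).trans (sum_card_divisors_div_le N))
  rw [one_div_mul_eq_div]
  gcongr
  exact_mod_cast (mem_filter.1 hm).2.le

theorem sum_Ioc_one_div_le (N : ℕ) : ∑ m ∈ Ioc 0 N, (1 : ℝ) / m ≤ 1 + Real.log N := by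
  rw [show Ioc 0 N = Icc 1 N from rfl]
  have h := harmonic_le_one_add_log N
  rw [harmonic_eq_sum_Icc] at h
  push_cast at h
  simpa only [one_div] using h

/-- `f` is controlled by values on prime powers: `f n` divides a product over the prime powers
exactly dividing `n`, and for each prime power exactly dividing `n` it has a divisor which,
for a given exponent, determines the prime. -/
structure PrimePowerControlled (f : ℕ → ℕ) : Prop where
  pos : ∀ n, 0 < n → 0 < f n
  le : ∀ n, 0 < n → (f n : ℝ) ≤ n * (1 + Real.log n)
  upper : ∃ g : ℕ → ℕ → ℕ, (∀ n, 0 < n → f n ∣ ∏ p ∈ n.primeFactors, g p (n.factorization p)) ∧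
    (∀ p a, p.Prime → 0 < a → 0 < g p a ∧ g p a ≤ 2 * p ^ a) ∧
    ∀ a, 0 < a → Set.InjOn (g · a) {p | p.Prime}
  lower : ∃ h : ℕ → ℕ → ℕ, (∀ n, 0 < n → ∀ p ∈ n.primeFactors, h p (n.factorization p) ∣ f n) ∧
    ∀ a, 0 < a → Set.InjOn (h · a) {p | p.Prime}

/-! ### Exceptional integers and sizes of fibres -/

theorem card_le_mul_sum_one_div {N : ℕ} {s : Finset ℕ} (hs : s ⊆ Ioc 0 N) :
    (#s : ℝ) ≤ N * ∑ n ∈ s, (1 : ℝ) / n := by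
  rw [mul_sum, card_eq_sum_ones, Nat.cast_sum]
  refine sum_le_sum fun n hn => ?_
  have := mem_Ioc.1 (hs hn)
  rw [mul_one_div, le_div_iff₀ (by exact_mod_cast this.1)]
  simpa using this.2

theorem factorization_mem_of_mem {N n p : ℕ} (hn : n ∈ Ioc 0 N) (hp : p ∈ n.primeFactors) :
    0 < n.factorization p ∧ n.factorization p ≤ Nat.log 2 N ∧ p ^ n.factorization p ≤ N := by
  rw [mem_Ioc] at hn
  have hpp := Nat.prime_of_mem_primeFactors hp
  have h1 : p ^ n.factorization p ≤ N :=
    (Nat.le_of_dvd hn.1 (Nat.ordProj_dvd n p)).trans hn.2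
  refine ⟨hpp.factorization_pos_of_dvd hn.1.ne' (Nat.dvd_of_mem_primeFactors hp), ?_, h1⟩
  exact Nat.le_log_of_pow_le one_lt_two ((Nat.pow_le_pow_left hpp.two_le _).trans h1)

/-- For fixed `a`, the bound `1/p^a ≤ 2/g p a` and injectivity in `p` turn the sum over primes into
a sum of `1/m` over distinct `m ≤ 2N` with many divisors. The factor `Nat.log 2 N` counts the
exponents `a`. -/
theorem card_exists_card_divisors_gt_le {g : ℕ → ℕ → ℕ}
    (hg : ∀ p a, p.Prime → 0 < a → 0 < g p a ∧ g p a ≤ 2 * p ^ a)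
    (hinj : ∀ a, 0 < a → Set.InjOn (g · a) {p | p.Prime}) (N K : ℕ) :
    (#{n ∈ Ioc 0 N | ∃ p ∈ n.primeFactors, 2 ^ K < #(g p (n.factorization p)).divisors} : ℝ) ≤
      N * (Nat.log 2 N * (2 * ((∑ m ∈ Ioc 0 (2 * N), (1 : ℝ) / m) ^ 2 / 2 ^ K))) := by
  set S : ℕ → Finset ℕ := fun a =>
    {p ∈ Ioc 0 N | p.Prime ∧ p ^ a ≤ N ∧ 2 ^ K < #(g p a).divisors} with hS
  have hsub : ({n ∈ Ioc 0 N | ∃ p ∈ n.primeFactors,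
      2 ^ K < #(g p (n.factorization p)).divisors} : Finset ℕ) ⊆
      (Ioc 0 (Nat.log 2 N)).biUnion fun a => (S a).biUnion fun p => {n ∈ Ioc 0 N | p ^ a ∣ n} := by
    intro n hn
    obtain ⟨hn, p, hp, hK⟩ := mem_filter.1 hn
    obtain ⟨h1, h2, h3⟩ := factorization_mem_of_mem hn hp
    simp only [mem_biUnion, hS, mem_filter]
    have hpp := Nat.prime_of_mem_primeFactors hp
    exact ⟨_, mem_Ioc.2 ⟨h1, h2⟩, p, ⟨mem_Ioc.2 ⟨hpp.pos, (Nat.le_self_pow h1.ne' p).trans h3⟩,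
      hpp, h3, hK⟩, hn, Nat.ordProj_dvd n p⟩
  have hSa : ∀ a ∈ Ioc 0 (Nat.log 2 N), ∑ p ∈ S a, (N : ℝ) / (p ^ a : ℕ) ≤
      N * (2 * ((∑ m ∈ Ioc 0 (2 * N), (1 : ℝ) / m) ^ 2 / 2 ^ K)) := by
    intro a ha
    have ha0 := (mem_Ioc.1 ha).1
    have hi : Set.InjOn (g · a) (S a) := fun p hp q hq h =>
      hinj a ha0 (mem_filter.1 hp).2.1 (mem_filter.1 hq).2.1 h
    calc ∑ p ∈ S a, (N : ℝ) / (p ^ a : ℕ) ≤ ∑ p ∈ S a, N * (2 * ((1 : ℝ) / (g p a : ℕ))) := by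
          refine sum_le_sum fun p hp => ?_
          obtain ⟨h1, h2⟩ := hg p a (mem_filter.1 hp).2.1 ha0
          have h3 : 0 < p ^ a := pow_pos (mem_filter.1 hp).2.1.pos a
          rw [div_eq_mul_one_div]
          gcongr
          rw [mul_one_div, div_le_div_iff₀ (by exact_mod_cast h3) (by exact_mod_cast h1)]
          rw [one_mul]
          exact_mod_cast h2
      _ = N * (2 * ∑ m ∈ (S a).image (g · a), (1 : ℝ) / m) := by
          rw [sum_image hi, mul_sum, mul_sum]
      _ ≤ _ := by
          gcongr
          refine le_trans (sum_le_sum_of_subset_of_nonneg ?_ fun _ _ _ => by positivity)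
            (sum_one_div_of_card_divisors_gt_le (2 * N) K)
          intro m hm
          obtain ⟨p, hp, rfl⟩ := mem_image.1 hm
          obtain ⟨-, hpp, h3, h4⟩ := mem_filter.1 hp
          obtain ⟨h1, h2⟩ := hg p a hpp ha0
          exact mem_filter.2 ⟨mem_Ioc.2 ⟨h1, by omega⟩, h4⟩
  calc _ ≤ (∑ a ∈ Ioc 0 (Nat.log 2 N), ∑ p ∈ S a, (N / p ^ a : ℕ) : ℝ) := by
        norm_cast
        refine (card_le_card hsub).trans (card_biUnion_le.trans (sum_le_sum fun a ha =>
          card_biUnion_le.trans (sum_le_sum fun p hp => ?_)))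
        rw [Nat.Ioc_filter_dvd_card_eq_div]
    _ ≤ ∑ a ∈ Ioc 0 (Nat.log 2 N), ∑ p ∈ S a, (N : ℝ) / (p ^ a : ℕ) := by
        refine sum_le_sum fun a _ => sum_le_sum fun p _ => Nat.cast_div_le
    _ ≤ _ := by
        refine (sum_le_sum hSa).trans ?_
        rw [sum_const, nsmul_eq_mul, Nat.card_Ioc, Nat.sub_zero]
        apply le_of_eq; ring

theorem prod_mem_pow_card {ι : Type*} (s : Finset ι) (u : ι → ℕ) (Q : Finset ℕ)
    (h : ∀ i ∈ s, u i ∈ Q) : ∏ i ∈ s, u i ∈ Q ^ #s := by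
  classical
  induction s using Finset.induction_on with
  | empty => simp
  | insert i s hi ih =>
    rw [prod_insert hi, card_insert_of_notMem hi, pow_succ']
    exact mul_mem_mul (h _ (mem_insert_self _ _)) (ih fun j hj => h j (mem_insert_of_mem hj))

/-- Every `n` in the fibre is a product of at most `K` prime powers, each fixed by an exponent and a
divisor of `m`. -/
theorem card_fiber_le {f : ℕ → ℕ} {h : ℕ → ℕ → ℕ}
    (hdvd : ∀ n, 0 < n → ∀ p ∈ n.primeFactors, h p (n.factorization p) ∣ f n)
    (hinj : ∀ a, 0 < a → Set.InjOn (h · a) {p | p.Prime}) (N K D m : ℕ) (hm : 0 < m)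
    (hD : #m.divisors ≤ D) :
    #{n ∈ Ioc 0 N | #n.divisors ≤ 2 ^ K ∧ f n = m} ≤ (Nat.log 2 N * D + 1) ^ K := by
  set T : ℕ → Finset ℕ := fun a => {p ∈ Ioc 0 N | p.Prime ∧ h p a ∣ m} with hT
  -- Including `1` pads products of fewer than `K` prime powers to exactly `K` factors.
  set Q : Finset ℕ :=
    insert 1 ((Ioc 0 (Nat.log 2 N)).biUnion fun a => (T a).image fun p => p ^ a) with hQ
  have hQcard : #Q ≤ Nat.log 2 N * D + 1 := by
    refine (card_insert_le _ _).trans (Nat.add_le_add_right ?_ 1)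
    refine (card_biUnion_le_card_mul _ _ D fun a ha => ?_).trans (by simp)
    refine card_image_le.trans (le_trans (card_le_card_of_injOn (h · a) (fun p hp => ?_) ?_) hD)
    · exact Nat.mem_divisors.2 ⟨(mem_filter.1 hp).2.2, hm.ne'⟩
    · exact fun p hp q hq e => hinj a (mem_Ioc.1 ha).1 (mem_filter.1 hp).2.1
        (mem_filter.1 hq).2.1 e
  refine le_trans (card_le_card fun n hn => ?_)
    ((card_pow_le (s := Q) (n := K)).trans (Nat.pow_le_pow_left hQcard K))
  obtain ⟨hnN, hτ, rfl⟩ := mem_filter.1 hn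
  have hn0 := (mem_Ioc.1 hnN).1
  have hω : #n.primeFactors ≤ K := (Nat.pow_le_pow_iff_right one_lt_two).1
    ((two_pow_card_primeFactors_le_card_divisors hn0.ne').trans hτ)
  refine pow_subset_pow_right (mem_insert_self _ _) hω ?_
  suffices ∏ p ∈ n.primeFactors, p ^ n.factorization p ∈ Q ^ #n.primeFactors by
    rwa [show ∏ p ∈ n.primeFactors, p ^ n.factorization p = n from
      Nat.prod_factorization_pow_eq_self hn0.ne'] at this
  refine prod_mem_pow_card _ _ _ fun p hp => mem_insert_of_mem ?_
  obtain ⟨h1, h2, h3⟩ := factorization_mem_of_mem hnN hp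
  have hpp := Nat.prime_of_mem_primeFactors hp
  exact mem_biUnion.2 ⟨_, mem_Ioc.2 ⟨h1, h2⟩, mem_image.2 ⟨p, mem_filter.2
    ⟨mem_Ioc.2 ⟨hpp.pos, (Nat.le_self_pow h1.ne' p).trans h3⟩, hpp, hdvd n hn0 p hp⟩, rfl⟩⟩

theorem PrimePowerControlled.card_preimage_le {f : ℕ → ℕ} (hf : PrimePowerControlled f)
    (M : Finset ℕ) (N K : ℕ) :
    (#{n ∈ Ioc 0 N | f n ∈ M} : ℝ) ≤
      #M * ((Nat.log 2 N : ℝ) * (2 ^ K) ^ K + 1) ^ K +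
      N * ((1 + Real.log N) ^ 2 / 2 ^ K +
        Nat.log 2 N * (2 * ((1 + Real.log (2 * N)) ^ 2 / 2 ^ K))) := by
  obtain ⟨g, hg1, hg2, hg3⟩ := hf.upper
  obtain ⟨h, hh1, hh2⟩ := hf.lower
  set B₁ : Finset ℕ := {n ∈ Ioc 0 N | 2 ^ K < #n.divisors} with hB₁
  set B₂ : Finset ℕ :=
    {n ∈ Ioc 0 N | ∃ p ∈ n.primeFactors, 2 ^ K < #(g p (n.factorization p)).divisors} with hB₂
  have key : #{n ∈ Ioc 0 N | f n ∈ M} ≤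
      #M * (Nat.log 2 N * (2 ^ K) ^ K + 1) ^ K + (#B₁ + #B₂) := by
    have hsub : ({n ∈ Ioc 0 N | f n ∈ M} : Finset ℕ) ⊆
        ({m ∈ M | 0 < m ∧ #m.divisors ≤ (2 ^ K) ^ K}.biUnion fun m =>
          {n ∈ Ioc 0 N | #n.divisors ≤ 2 ^ K ∧ f n = m}) ∪ (B₁ ∪ B₂) := by
      intro n hn
      obtain ⟨hn, hnM⟩ := mem_filter.1 hn
      have hn0 := (mem_Ioc.1 hn).1
      by_cases h1 : n ∈ B₁
      · exact mem_union_right _ (mem_union_left _ h1)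
      by_cases h2 : n ∈ B₂
      · exact mem_union_right _ (mem_union_right _ h2)
      have hτ : #n.divisors ≤ 2 ^ K := not_lt.1 fun hlt => h1 (mem_filter.2 ⟨hn, hlt⟩)
      refine mem_union_left _ (mem_biUnion.2 ⟨f n, mem_filter.2 ⟨hnM, hf.pos n hn0, ?_⟩,
        mem_filter.2 ⟨hn, hτ, rfl⟩⟩)
      have hω : #n.primeFactors ≤ K := (Nat.pow_le_pow_iff_right one_lt_two).1
        ((two_pow_card_primeFactors_le_card_divisors hn0.ne').trans hτ)
      have hne : ∏ p ∈ n.primeFactors, g p (n.factorization p) ≠ 0 :=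
        prod_ne_zero_iff.2 fun p hp => (hg2 p _ (Nat.prime_of_mem_primeFactors hp)
          (factorization_mem_of_mem hn hp).1).1.ne'
      refine (card_le_card (Nat.divisors_subset_of_dvd hne (hg1 n hn0))).trans
        ((card_divisors_prod_le _ _).trans ?_)
      refine (prod_le_pow_card _ _ (2 ^ K) fun p hp => ?_).trans
        (Nat.pow_le_pow_right (by positivity) hω)
      exact not_lt.1 fun hlt => h2 (mem_filter.2 ⟨hn, p, hp, hlt⟩)
    refine (card_le_card hsub).trans ((card_union_le _ _).trans
      (add_le_add ?_ (card_union_le _ _)))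
    refine (card_biUnion_le_card_mul _ _ _ fun m hm => ?_).trans
      (Nat.mul_le_mul_right _ (card_filter_le _ _))
    obtain ⟨-, hm0, hmD⟩ := mem_filter.1 hm
    exact card_fiber_le hh1 hh2 N K _ m hm0 hmD
  have hb1 : (#B₁ : ℝ) ≤ N * ((1 + Real.log N) ^ 2 / 2 ^ K) := by
    refine (card_le_mul_sum_one_div (filter_subset _ _)).trans ?_
    gcongr
    refine (sum_one_div_of_card_divisors_gt_le N K).trans ?_
    gcongr
    exact sum_Ioc_one_div_le N
  have hb2 : (#B₂ : ℝ) ≤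
      N * (Nat.log 2 N * (2 * ((1 + Real.log (2 * N)) ^ 2 / 2 ^ K))) := by
    refine (card_exists_card_divisors_gt_le hg2 hg3 N K).trans ?_
    gcongr
    exact_mod_cast sum_Ioc_one_div_le (2 * N)
  have := (Nat.cast_le (α := ℝ)).2 key
  push_cast at this
  linarith

/-! ### The functions `φ`, `λ` and `σ` -/

theorem natCast_le_mul_one_add_log {m n : ℕ} (h : m ≤ n) :
    (m : ℝ) ≤ n * (1 + Real.log n) := by
  have h1 : (m : ℝ) ≤ n := by exact_mod_cast h
  have h2 : 0 ≤ Real.log n := Real.log_natCast_nonneg n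
  nlinarith [Nat.cast_nonneg (α := ℝ) n]

theorem injOn_prime_sub_one : Set.InjOn (fun p : ℕ => p - 1) {p | p.Prime} := by
  intro p hp q hq h
  have := Nat.Prime.pos hp
  have := Nat.Prime.pos hq
  simp only at h
  omega

theorem totient_dvd_prod (n : ℕ) (hn : 0 < n) :
    n.totient ∣ ∏ p ∈ n.primeFactors, p ^ (n.factorization p - 1) * (p - 1) := by
  rw [Nat.totient_eq_prod_factorization hn.ne']
  exact dvd_rfl

theorem totient_primePow_pos_and_le {p a : ℕ} (hp : p.Prime) (ha : 0 < a) :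
    0 < p ^ (a - 1) * (p - 1) ∧ p ^ (a - 1) * (p - 1) ≤ 2 * p ^ a := by
  have h1 := hp.two_le
  refine ⟨Nat.mul_pos (pow_pos hp.pos _) (by omega), ?_⟩
  obtain ⟨b, rfl⟩ : ∃ b, a = b + 1 := ⟨a - 1, by omega⟩
  rw [Nat.add_sub_cancel, pow_succ, mul_left_comm]
  exact Nat.mul_le_mul_left _ (by omega)

theorem injOn_totient_primePow (a : ℕ) :
    Set.InjOn (fun p : ℕ => p ^ (a - 1) * (p - 1)) {p | p.Prime} := by
  apply StrictMonoOn.injOn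
  intro p hp q hq h
  have h1 := Nat.Prime.two_le hp
  exact Nat.mul_lt_mul_of_le_of_lt (Nat.pow_le_pow_left h.le _) (by omega)
    (pow_pos (Nat.Prime.pos hq) _)

theorem PrimePowerControlled.totient : PrimePowerControlled Nat.totient where
  pos _ hn := Nat.totient_pos.2 hn
  le n _ := natCast_le_mul_one_add_log (Nat.totient_le n)
  upper := ⟨fun p a => p ^ (a - 1) * (p - 1), totient_dvd_prod,
    fun _ _ => totient_primePow_pos_and_le, fun a _ => injOn_totient_primePow a⟩
  lower := ⟨fun p _ => p - 1, fun n _ p hp => by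
    simp only [← Nat.totient_prime (Nat.prime_of_mem_primeFactors hp)]
    exact Nat.totient_dvd_of_dvd (Nat.dvd_of_mem_primeFactors hp),
    fun _ _ => injOn_prime_sub_one⟩

theorem carmichael_pos {n : ℕ} (hn : 0 < n) : 0 < ArithmeticFunction.carmichael n :=
  Nat.pos_of_dvd_of_pos (ArithmeticFunction.carmichael_dvd_totient n) (Nat.totient_pos.2 hn)

theorem sub_one_dvd_carmichael {n p : ℕ} (hp : p.Prime) (h : p ∣ n) :
    p - 1 ∣ ArithmeticFunction.carmichael n := by
  rcases eq_or_ne p 2 with rfl | h2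
  · simp
  refine dvd_trans ?_ (ArithmeticFunction.carmichael_dvd h)
  have := ArithmeticFunction.carmichael_pow_of_prime_ne_two 1 hp h2
  rw [pow_one] at this
  rw [this, Nat.totient_prime hp]

/-- `λ(n)` is not a product of local factors, but it divides `φ(n)`, so the upper data of `φ` still
serve. -/
theorem PrimePowerControlled.carmichael :
    PrimePowerControlled fun n => ArithmeticFunction.carmichael n where
  pos _ hn := carmichael_pos hn
  le n hn := natCast_le_mul_one_add_log ((Nat.le_of_dvd (Nat.totient_pos.2 hn)
    (ArithmeticFunction.carmichael_dvd_totient n)).trans (Nat.totient_le n))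
  upper := ⟨fun p a => p ^ (a - 1) * (p - 1), fun n hn =>
    (ArithmeticFunction.carmichael_dvd_totient n).trans (totient_dvd_prod n hn),
    fun _ _ => totient_primePow_pos_and_le, fun a _ => injOn_totient_primePow a⟩
  lower := ⟨fun p _ => p - 1, fun _ _ _ hp =>
    sub_one_dvd_carmichael (Nat.prime_of_mem_primeFactors hp) (Nat.dvd_of_mem_primeFactors hp),
    fun _ _ => injOn_prime_sub_one⟩

theorem sigma_one_eq_prod {n : ℕ} (hn : 0 < n) : ArithmeticFunction.sigma 1 n =
    ∏ p ∈ n.primeFactors, ∑ i ∈ range (n.factorization p + 1), p ^ i := by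
  rw [ArithmeticFunction.isMultiplicative_sigma.multiplicative_factorization _ hn.ne']
  exact prod_congr rfl fun p hp =>
    ArithmeticFunction.sigma_one_apply_prime_pow (Nat.prime_of_mem_primeFactors hp)

theorem sum_range_pow_le {p : ℕ} (hp : 2 ≤ p) (a : ℕ) :
    ∑ i ∈ range (a + 1), p ^ i ≤ 2 * p ^ a := by
  induction a with
  | zero => simp
  | succ a ih =>
    rw [sum_range_succ, two_mul]
    refine Nat.add_le_add_right (ih.trans ?_) _
    rw [pow_succ']
    exact Nat.mul_le_mul_right _ hp

theorem injOn_sum_range_pow {a : ℕ} (ha : 0 < a) :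
    Set.InjOn (fun p : ℕ => ∑ i ∈ range (a + 1), p ^ i) {p | p.Prime} := by
  refine StrictMono.injective (fun p q h => ?_) |>.injOn
  refine sum_lt_sum (fun i _ => Nat.pow_le_pow_left h.le i) ⟨1, mem_range.2 (by omega), ?_⟩
  simpa using h

theorem sigma_one_le (n : ℕ) :
    (ArithmeticFunction.sigma 1 n : ℝ) ≤ n * (1 + Real.log n) := by
  refine le_trans ?_ (mul_le_mul_of_nonneg_left (sum_Ioc_one_div_le n) n.cast_nonneg)
  rw [ArithmeticFunction.sigma_one_apply, ← Nat.sum_div_divisors, Nat.cast_sum, mul_sum]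
  refine (sum_le_sum fun d _ => ?_).trans
    (sum_le_sum_of_subset_of_nonneg (t := Ioc 0 n) (fun d hd => ?_) fun _ _ _ => by positivity)
  · rw [mul_one_div]
    exact Nat.cast_div_le
  · exact mem_Ioc.2 ⟨Nat.pos_of_mem_divisors hd, Nat.divisor_le hd⟩

/-- The lower data must depend on the exponent: `p + 1` need not divide `σ(p^a)`, so the whole local
factor is used. -/
theorem PrimePowerControlled.sigma :
    PrimePowerControlled fun n => ArithmeticFunction.sigma 1 n where
  pos n hn := ArithmeticFunction.sigma_pos 1 n hn.ne'
  le n _ := sigma_one_le n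
  upper := ⟨fun p a => ∑ i ∈ range (a + 1), p ^ i, fun n hn => (sigma_one_eq_prod hn).dvd,
    fun _ a hp _ => ⟨sum_pos (fun i _ => pow_pos hp.pos i) ⟨0, by simp⟩,
      sum_range_pow_le hp.two_le a⟩, fun a ha => injOn_sum_range_pow ha⟩
  lower := ⟨fun p a => ∑ i ∈ range (a + 1), p ^ i, fun n hn p hp => by
    simp only [sigma_one_eq_prod hn]
    exact dvd_prod_of_mem (fun p => ∑ i ∈ range (n.factorization p + 1), p ^ i) hp,
    fun a ha => injOn_sum_range_pow ha⟩

theorem primePowerControlled_of_mem_basicFunctions {f : ℕ → ℕ} (hf : f ∈ basicFunctions) :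
    PrimePowerControlled f := by
  rcases hf with rfl | rfl | rfl
  exacts [.totient, .sigma, .carmichael]

/-! ### Choice of parameters -/

/-- The constant `12` is chosen so that the cube of `4 log x + 2` is at most `exp(s/4)`, where `s =
(log x)^δ`. -/
theorem eventually_log_le_rpow_div {δ : ℝ} (hδ : 0 < δ) :
    ∀ᶠ x : ℝ in atTop, Real.log (4 * Real.log x + 2) ≤ Real.log x ^ δ / 12 := by
  refine Real.tendsto_log_atTop.eventually (p := fun t => Real.log (4 * t + 2) ≤ t ^ δ / 12) ?_
  filter_upwards [(isLittleO_log_rpow_atTop hδ).bound (c := 1 / 24) (by norm_num),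
    eventually_ge_atTop 5] with t ht h5
  rw [Real.norm_of_nonneg (Real.log_nonneg (by linarith)),
    Real.norm_of_nonneg (Real.rpow_nonneg (by linarith) δ)] at ht
  have h1 : Real.log (4 * t + 2) ≤ Real.log (t ^ 2) :=
    Real.log_le_log (by linarith) (by nlinarith)
  rw [Real.log_pow] at h1
  push_cast at h1
  linarith

theorem eventually_le_log_rpow {δ : ℝ} (hδ : 0 < δ) (C : ℝ) :
    ∀ᶠ x : ℝ in atTop, C ≤ Real.log x ^ δ :=
  ((tendsto_rpow_atTop hδ).comp Real.tendsto_log_atTop).eventually_ge_atTop C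

theorem natLog_floor_le {x : ℝ} (hx : 1 ≤ x) : (Nat.log 2 ⌊x⌋₊ : ℝ) ≤ 2 * Real.log x := by
  have hN : 0 < ⌊x⌋₊ := Nat.floor_pos.2 hx
  refine (Real.natLog_le_logb _ _).trans ?_
  have h1 : Real.log (⌊x⌋₊ : ℝ) ≤ Real.log x :=
    Real.log_le_log (by exact_mod_cast hN) (Nat.floor_le (by linarith))
  have h2 := Real.log_two_gt_d9
  have h3 := Real.log_nonneg hx
  rw [Real.logb, Nat.cast_ofNat, div_le_iff₀ (by linarith)]
  nlinarith

theorem two_pow_le_exp (k : ℕ) : (2 : ℝ) ^ k ≤ Real.exp k := by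
  rw [← Real.exp_one_pow]
  have := Real.add_one_le_exp 1
  gcongr
  linarith

/-- The exponent is about `K · K^2 ≤ s^3`; rounding up to `s^4` absorbs the lower order terms. -/
theorem mul_pow_pow_add_one_le_exp {t s : ℝ} {K : ℕ} (ht : 0 ≤ t) (hs : 2 ≤ s)
    (hK : (K : ℝ) ≤ s) (hlog : Real.log (4 * t + 2) ≤ s / 12) :
    (2 * t * (2 ^ K) ^ K + 1) ^ K ≤ Real.exp (s ^ 4) := by
  have hE : ((2 : ℝ) ^ K) ^ K ≤ Real.exp (s ^ 2) := by
    rw [← pow_mul]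
    refine (two_pow_le_exp _).trans (Real.exp_le_exp.2 ?_)
    push_cast
    nlinarith [Nat.cast_nonneg (α := ℝ) K]
  have h1 : 4 * t + 2 ≤ Real.exp (s / 12) := by
    rwa [← Real.log_le_iff_le_exp (by linarith)]
  have h2 : 2 * t * (2 ^ K) ^ K + 1 ≤ Real.exp (s / 12 + s ^ 2) := by
    rw [Real.exp_add]
    have h3 : 1 ≤ Real.exp (s ^ 2) := Real.one_le_exp (by positivity)
    have h4 : 2 * t * (2 ^ K) ^ K ≤ 2 * t * Real.exp (s ^ 2) :=
      mul_le_mul_of_nonneg_left hE (by linarith)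
    nlinarith
  calc (2 * t * (2 ^ K) ^ K + 1) ^ K ≤ Real.exp (s / 12 + s ^ 2) ^ K := by gcongr
    _ = Real.exp (K * (s / 12 + s ^ 2)) := (Real.exp_nat_mul _ _).symm
    _ ≤ Real.exp (s ^ 4) := by
      refine Real.exp_le_exp.2 ((mul_le_mul_of_nonneg_right hK (by positivity)).trans ?_)
      have h5 : s ≤ s ^ 2 / 2 := by nlinarith
      have h6 : s ^ 3 ≤ s ^ 4 / 2 := by nlinarith [pow_pos (by linarith : 0 < s) 3]
      have h7 : s ^ 2 ≤ s ^ 4 / 4 := by nlinarith [sq_nonneg s]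
      nlinarith

/-- The numerators total at most `exp(s/4)`, while `2^K ≥ exp((s - 1)/2)`; for `s ≥ 36` the
difference covers `√s`. -/
theorem sq_div_two_pow_le_exp {t s : ℝ} {K : ℕ} (ht : 0 ≤ t) (hs : 36 ≤ s)
    (hK : s < K + 1) (hlog : Real.log (4 * t + 2) ≤ s / 12) :
    (t + 2) ^ 2 / 2 ^ K + 2 * t * (2 * ((t + 2) ^ 2 / 2 ^ K)) ≤ Real.exp (-√s) := by
  have h1 : 4 * t + 2 ≤ Real.exp (s / 12) := by
    rwa [← Real.log_le_iff_le_exp (by linarith)]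
  have h2 : Real.exp ((s - 1) / 2) ≤ 2 ^ K := by
    rw [← Real.rpow_natCast, Real.rpow_def_of_pos (by norm_num)]
    refine Real.exp_le_exp.2 ?_
    have := Real.log_two_gt_d9
    nlinarith
  have h3 : (t + 2) ^ 2 * (1 + 4 * t) ≤ Real.exp (s / 4) := by
    calc (t + 2) ^ 2 * (1 + 4 * t) ≤ (4 * t + 2) ^ 2 * (4 * t + 2) :=
          mul_le_mul (pow_le_pow_left₀ (by linarith) (by linarith) 2) (by linarith)
            (by linarith) (by positivity)
      _ = (4 * t + 2) ^ 3 := by ring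
      _ ≤ Real.exp (s / 12) ^ 3 := by gcongr
      _ = Real.exp (s / 4) := by rw [← Real.exp_nat_mul]; congr 1; push_cast; ring
  rw [show (t + 2) ^ 2 / 2 ^ K + 2 * t * (2 * ((t + 2) ^ 2 / 2 ^ K)) =
    (t + 2) ^ 2 * (1 + 4 * t) / 2 ^ K by ring, div_le_iff₀ (by positivity)]
  refine h3.trans (le_trans ?_ (mul_le_mul_of_nonneg_left h2 (Real.exp_nonneg _)))
  rw [← Real.exp_add]
  refine Real.exp_le_exp.2 ?_
  have h4 : 6 ≤ √s := Real.le_sqrt_of_sq_le (by linarith)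
  have h5 := Real.sq_sqrt (by linarith : 0 ≤ s)
  nlinarith

theorem PrimePowerControlled.eventually_card_preimage_le {f : ℕ → ℕ}
    (hf : PrimePowerControlled f) {δ : ℝ} (hδ : 0 < δ) :
    ∀ᶠ x : ℝ in atTop, ∀ M : Finset ℕ, (#{n ∈ Ioc 0 ⌊x⌋₊ | f n ∈ M} : ℝ) ≤
      #M * Real.exp ((Real.log x ^ δ) ^ 4) + x * Real.exp (-√(Real.log x ^ δ)) := by
  filter_upwards [eventually_log_le_rpow_div hδ, eventually_le_log_rpow hδ 36,
    eventually_ge_atTop 1] with x hlog hs hx M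
  set s := Real.log x ^ δ with hs_def
  have ht := Real.log_nonneg hx
  have hN : (1 : ℝ) ≤ ⌊x⌋₊ := by exact_mod_cast Nat.floor_pos.2 hx
  have hNx : (⌊x⌋₊ : ℝ) ≤ x := Nat.floor_le (by linarith)
  have h1 : Real.log (⌊x⌋₊ : ℝ) ≤ Real.log x := Real.log_le_log (by linarith) hNx
  have h2 : Real.log (2 * (⌊x⌋₊ : ℝ)) ≤ Real.log x + 1 := by
    rw [Real.log_mul (by norm_num) (by linarith)]
    have := Real.log_two_lt_d9
    linarith
  have h3 := natLog_floor_le hx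
  have h4 : 0 ≤ Real.log (⌊x⌋₊ : ℝ) := Real.log_nonneg hN
  have h5 : 0 ≤ Real.log (2 * (⌊x⌋₊ : ℝ)) := Real.log_nonneg (by linarith)
  refine (hf.card_preimage_le M ⌊x⌋₊ ⌊s⌋₊).trans (add_le_add ?_ ?_)
  · refine mul_le_mul_of_nonneg_left (le_trans ?_ (mul_pow_pow_add_one_le_exp ht
      (by linarith) (Nat.floor_le (by linarith)) hlog)) (Nat.cast_nonneg _)
    gcongr
  · refine mul_le_mul hNx (le_trans ?_ (sq_div_two_pow_le_exp ht hs (Nat.lt_floor_add_one s) hlog))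
      (by positivity) (by linarith)
    have h6 : 1 + Real.log (⌊x⌋₊ : ℝ) ≤ Real.log x + 2 := by linarith
    have h7 : 1 + Real.log (2 * (⌊x⌋₊ : ℝ)) ≤ Real.log x + 2 := by linarith
    have h8 : 0 ≤ 1 + Real.log (⌊x⌋₊ : ℝ) := by linarith
    have h9 : 0 ≤ 1 + Real.log (2 * (⌊x⌋₊ : ℝ)) := by linarith
    generalize 1 + Real.log (⌊x⌋₊ : ℝ) = a at h6 h8 ⊢
    generalize 1 + Real.log (2 * (⌊x⌋₊ : ℝ)) = b at h7 h9 ⊢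
    gcongr

/-! ### Thin sets -/

theorem ncard_thin_set_eq (E : Set ℕ) (x : ℝ) (hx : 0 ≤ x) [DecidablePred (· ∈ E)] :
    {n : ℕ | n ∈ E ∧ 1 ≤ n ∧ (n : ℝ) ≤ x}.ncard = #{n ∈ Ioc 0 ⌊x⌋₊ | n ∈ E} := by
  rw [← Set.ncard_coe_finset]
  congr 1
  ext n
  simp only [Set.mem_ofPred_eq, coe_filter, mem_Ioc, Nat.le_floor_iff hx]
  tauto

theorem truncLog_eventuallyEq : ∀ᶠ x : ℝ in atTop, truncLog x = Real.log x := by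
  filter_upwards [Real.tendsto_log_atTop.eventually_ge_atTop 1] with x hx
  exact max_eq_right hx

open Classical in
theorem IsThin.exists_eventually_card_le {E : Set ℕ} (hE : IsThin E) :
    ∃ θ : ℝ, 0 < θ ∧ ∀ᶠ x : ℝ in atTop,
      (#{n ∈ Ioc 0 ⌊x⌋₊ | n ∈ E} : ℝ) ≤ x * Real.exp (-Real.log x ^ θ) := by
  obtain ⟨θ, hθ, x₀, hx₀, h⟩ := hE
  refine ⟨θ, hθ, ?_⟩
  filter_upwards [truncLog_eventuallyEq, eventually_gt_atTop x₀] with x ht hx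
  have := (h x hx).le
  rwa [ncard_thin_set_eq E x (hx₀.trans hx).le, ht, div_eq_mul_inv, ← Real.exp_neg] at this

open Classical in
-- Halving `θ` absorbs the logarithmic factor.
theorem isThin_of_eventually_card_le {E : Set ℕ} {θ : ℝ} (hθ : 0 < θ)
    (h : ∀ᶠ x : ℝ in atTop, (#{n ∈ Ioc 0 ⌊x⌋₊ | n ∈ E} : ℝ) ≤
      x * ((2 + Real.log x) * Real.exp (-Real.log x ^ θ))) : IsThin E := by
  have hθ2 : 0 < θ / 2 := by linarith
  have key : ∀ᶠ x : ℝ in atTop, ({n : ℕ | n ∈ E ∧ 1 ≤ n ∧ (n : ℝ) ≤ x}.ncard : ℝ) <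
      x / Real.exp (truncLog x ^ (θ / 2)) := by
    filter_upwards [h, truncLog_eventuallyEq, eventually_log_le_rpow_div hθ2,
      eventually_le_log_rpow hθ2 2, eventually_ge_atTop 1] with x hx ht hlog hs hx1
    have ht0 := Real.log_nonneg hx1
    rw [ncard_thin_set_eq E x (by linarith), ht, div_eq_mul_inv, ← Real.exp_neg]
    refine hx.trans_lt (mul_lt_mul_of_pos_left ?_ (by linarith))
    have hsq : Real.log x ^ θ = (Real.log x ^ (θ / 2)) ^ 2 := by
      rw [← Real.rpow_natCast, ← Real.rpow_mul ht0]
      congr 1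
      push_cast
      ring
    rw [hsq]
    set s := Real.log x ^ (θ / 2)
    have h1 : 4 * Real.log x + 2 ≤ Real.exp (s / 12) := by
      rwa [← Real.log_le_iff_le_exp (by linarith)]
    calc (2 + Real.log x) * Real.exp (-s ^ 2) ≤ Real.exp (s / 12) * Real.exp (-s ^ 2) := by
          gcongr
          linarith
      _ = Real.exp (s / 12 + -s ^ 2) := (Real.exp_add _ _).symm
      _ < Real.exp (-s) := Real.exp_lt_exp.2 (by nlinarith)
  obtain ⟨a, ha⟩ := eventually_atTop.1 key
  exact ⟨θ / 2, hθ2, max a 1, by positivity, fun x hx => ha x ((le_max_left _ _).trans hx.le)⟩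

theorem IsThin.mono {E F : Set ℕ} (hF : IsThin F) (h : ∀ n, 0 < n → n ∈ E → n ∈ F) :
    IsThin E := by
  obtain ⟨θ, hθ, x₀, hx₀, hx⟩ := hF
  refine ⟨θ, hθ, x₀, hx₀, fun x hxx => lt_of_le_of_lt ?_ (hx x hxx)⟩
  refine Nat.cast_le.2 (Set.ncard_le_ncard (fun n hn => ⟨h n hn.2.1 hn.1, hn.2⟩) ?_)
  exact (Set.finite_Iic ⌊x⌋₊).subset fun n hn => Nat.le_floor hn.2.2

theorem IsThin.union {E F : Set ℕ} (hE : IsThin E) (hF : IsThin F) : IsThin (E ∪ F) := by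
  classical
  obtain ⟨θ₁, h1, hE⟩ := hE.exists_eventually_card_le
  obtain ⟨θ₂, h2, hF⟩ := hF.exists_eventually_card_le
  refine isThin_of_eventually_card_le (lt_min h1 h2) ?_
  filter_upwards [hE, hF, Real.tendsto_log_atTop.eventually_ge_atTop 1,
    eventually_ge_atTop 0] with x hxE hxF ht hx
  have hle : ∀ θ, min θ₁ θ₂ ≤ θ → x * Real.exp (-Real.log x ^ θ) ≤
      x * Real.exp (-Real.log x ^ min θ₁ θ₂) := fun θ hθ => by
    gcongr
  have h4 : 0 ≤ x * Real.exp (-Real.log x ^ min θ₁ θ₂) := by positivity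
  have := hle _ (min_le_left _ _)
  have := hle _ (min_le_right _ _)
  have := mul_nonneg (by linarith : 0 ≤ Real.log x) h4
  calc _ ≤ ((#{n ∈ Ioc 0 ⌊x⌋₊ | n ∈ E} + #{n ∈ Ioc 0 ⌊x⌋₊ | n ∈ F} : ℕ) : ℝ) := by
        refine Nat.cast_le.2 (le_trans (card_le_card fun n hn => ?_) (card_union_le _ _))
        simp only [mem_filter, mem_union, Set.mem_union] at hn ⊢
        tauto
    _ ≤ _ := by
        push_cast
        linarith

theorem isThin_empty : IsThin ∅ := by
  refine ⟨1, one_pos, 1, one_pos, fun x hx => ?_⟩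
  have : 0 < x := by linarith
  simp only [Set.mem_empty_iff_false, false_and, Set.ofPred_false, Set.ncard_empty, Nat.cast_zero]
  positivity

theorem log_rpow_sixteenth_pow {t θ : ℝ} (ht : 0 ≤ t) (k : ℕ) :
    (t ^ (θ / 16)) ^ k = t ^ (θ * k / 16) := by
  rw [← Real.rpow_natCast, ← Real.rpow_mul ht]
  congr 1
  ring

/-! ### Preimages of thin sets and the square root bound -/

/-- Put `u = (log x)^(θ/16)`. Fibres cost `exp(u^8)`, thinness of `E` saves `exp(u^16)`, and the
exceptional set saves `exp(u)`. -/
theorem PrimePowerControlled.isThin_preimage {f : ℕ → ℕ} (hf : PrimePowerControlled f)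
    {E : Set ℕ} (hE : IsThin E) : IsThin {n | f n ∈ E} := by
  classical
  obtain ⟨θ, hθ, hE⟩ := hE.exists_eventually_card_le
  refine isThin_of_eventually_card_le (θ := θ / 16) (by linarith) ?_
  -- Values of `f` can exceed `x`, as for `σ`, so `E` is counted up to `x (1 + log x)`.
  have hy : Tendsto (fun x : ℝ => x * (1 + Real.log x)) atTop atTop :=
    tendsto_id.atTop_mul_atTop₀ (tendsto_atTop_add_const_left _ _ Real.tendsto_log_atTop)
  filter_upwards [hf.eventually_card_preimage_le (δ := θ / 8) (by linarith), hy.eventually hE,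
    eventually_le_log_rpow (δ := θ / 16) (by linarith) 2, eventually_ge_atTop 1]
    with x hx hxE hs hx1
  have ht := Real.log_nonneg hx1
  set t := Real.log x with ht_def
  set y := x * (1 + t) with hy_def
  have hxy : x ≤ y := by nlinarith
  have hcard : (#{m ∈ Ioc 0 ⌊y⌋₊ | m ∈ E} : ℝ) ≤ y * Real.exp (-t ^ θ) := by
    refine hxE.trans ?_
    have hlog : t ≤ Real.log y := Real.log_le_log (by linarith) hxy
    change y * Real.exp (-Real.log y ^ θ) ≤ _
    have hp : t ^ θ ≤ Real.log y ^ θ := Real.rpow_le_rpow ht hlog hθ.le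
    exact mul_le_mul_of_nonneg_left (Real.exp_le_exp.2 (neg_le_neg hp)) (by linarith)
  have hsub : #{n ∈ Ioc 0 ⌊x⌋₊ | n ∈ {n | f n ∈ E}} ≤
      #{n ∈ Ioc 0 ⌊x⌋₊ | f n ∈ ({m ∈ Ioc 0 ⌊y⌋₊ | m ∈ E} : Finset ℕ)} := by
    refine card_le_card fun n hn => ?_
    obtain ⟨hn, hnE⟩ := mem_filter.1 hn
    obtain ⟨hn0, hnx⟩ := mem_Ioc.1 hn
    refine mem_filter.2 ⟨hn, mem_filter.2 ⟨mem_Ioc.2 ⟨hf.pos n hn0, Nat.le_floor ?_⟩, hnE⟩⟩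
    refine (hf.le n hn0).trans ?_
    have h1 : (n : ℝ) ≤ x := (Nat.le_floor_iff (by linarith)).1 hnx
    have h2 : Real.log n ≤ t := Real.log_le_log (by exact_mod_cast hn0) h1
    have h3 := Real.log_natCast_nonneg n
    rw [hy_def]
    gcongr
  refine ((Nat.cast_le.2 hsub).trans (hx _)).trans ?_
  have e1 : t ^ (θ / 8) = (t ^ (θ / 16)) ^ 2 := by
    rw [log_rpow_sixteenth_pow ht]; congr 1; push_cast; ring
  have e2 : t ^ θ = (t ^ (θ / 16)) ^ 16 := by
    rw [log_rpow_sixteenth_pow ht]; congr 1; push_cast; ring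
  rw [e1, Real.sqrt_sq (by linarith)]
  rw [e2] at hcard
  set s := t ^ (θ / 16)
  have h1 : y * Real.exp (-s ^ 16) * Real.exp ((s ^ 2) ^ 4) ≤ y * Real.exp (-s) := by
    rw [mul_assoc, ← Real.exp_add]
    refine mul_le_mul_of_nonneg_left (Real.exp_le_exp.2 ?_) (by linarith)
    have h8 : s ≤ s ^ 8 := le_self_pow₀ (by linarith) (by norm_num)
    nlinarith
  have h2 := mul_le_mul_of_nonneg_right hcard (Real.exp_nonneg ((s ^ 2) ^ 4))
  calc _ ≤ y * Real.exp (-s) + x * Real.exp (-s) := by linarith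
    _ = x * ((2 + t) * Real.exp (-s)) := by rw [hy_def]; ring

/-- There are at most `√x = x exp(-(log x)/2)` possible values; with `u = (log x)^(1/16) ≥ 2`, the
saving `u^16/2` beats the fibre cost `u^8` with `u` to spare. -/
theorem PrimePowerControlled.isThin_lt_sqrt {f : ℕ → ℕ} (hf : PrimePowerControlled f) :
    IsThin {n | (f n : ℝ) < √n} := by
  classical
  refine isThin_of_eventually_card_le (θ := 1 / 16) (by norm_num) ?_
  filter_upwards [hf.eventually_card_preimage_le (δ := 1 / 8) (by norm_num),
    eventually_le_log_rpow (δ := 1 / 16) (by norm_num) 2, eventually_ge_atTop 1]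
    with x hx hs hx1
  have ht := Real.log_nonneg hx1
  have hsqrt : √x = x * Real.exp (-(Real.log x / 2)) := by
    have h1 : Real.exp (-(Real.log x / 2)) * Real.exp (-(Real.log x / 2)) = x⁻¹ := by
      rw [← Real.exp_add, ← neg_add, add_halves, Real.exp_neg, Real.exp_log (by linarith)]
    rw [Real.sqrt_eq_iff_mul_self_eq (by linarith) (by positivity), mul_mul_mul_comm, h1,
      mul_assoc, mul_inv_cancel₀ (by linarith), mul_one]
  set t := Real.log x with ht_def
  have hsub : #{n ∈ Ioc 0 ⌊x⌋₊ | n ∈ {n : ℕ | (f n : ℝ) < √n}} ≤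
      #{n ∈ Ioc 0 ⌊x⌋₊ | f n ∈ Ioc 0 ⌊√x⌋₊} := by
    refine card_le_card fun n hn => ?_
    obtain ⟨hn, hnE⟩ := mem_filter.1 hn
    obtain ⟨hn0, hnx⟩ := mem_Ioc.1 hn
    refine mem_filter.2 ⟨hn, mem_Ioc.2 ⟨hf.pos n hn0, Nat.le_floor ?_⟩⟩
    exact (le_of_lt hnE).trans (Real.sqrt_le_sqrt ((Nat.le_floor_iff (by linarith)).1 hnx))
  refine ((Nat.cast_le.2 hsub).trans (hx _)).trans ?_
  have hcard : (#(Ioc 0 ⌊√x⌋₊) : ℝ) ≤ x * Real.exp (-(t / 2)) := by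
    rw [← hsqrt, Nat.card_Ioc, Nat.sub_zero]
    exact Nat.floor_le (Real.sqrt_nonneg x)
  have e1 : t ^ ((1 : ℝ) / 8) = (t ^ ((1 : ℝ) / 16)) ^ 2 := by
    rw [log_rpow_sixteenth_pow ht]; congr 1; push_cast; ring
  have e2 : t = (t ^ ((1 : ℝ) / 16)) ^ 16 := by
    rw [log_rpow_sixteenth_pow ht]; norm_num
  rw [e1, Real.sqrt_sq (by linarith)]
  set s := t ^ ((1 : ℝ) / 16)
  have h1 : x * Real.exp (-(t / 2)) * Real.exp ((s ^ 2) ^ 4) ≤ x * Real.exp (-s) := by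
    rw [mul_assoc, ← Real.exp_add]
    refine mul_le_mul_of_nonneg_left (Real.exp_le_exp.2 ?_) (by linarith)
    have h8 : s ≤ s ^ 8 := le_self_pow₀ (by linarith) (by norm_num)
    have h9 : (2 : ℝ) ^ 8 ≤ s ^ 8 := by gcongr
    rw [e2]
    nlinarith
  have h2 := mul_le_mul_of_nonneg_right hcard (Real.exp_nonneg ((s ^ 2) ^ 4))
  have h3 : 0 ≤ x * (t * Real.exp (-s)) := by positivity
  linarith

/-! ### Compositions -/

theorem composition_cons (f : ℕ → ℕ) (L : List (ℕ → ℕ)) (n : ℕ) :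
    composition (f :: L) n = f (composition L n) := rfl

theorem isThin_composition_preimage {L : List (ℕ → ℕ)} (hL : ∀ f ∈ L, PrimePowerControlled f)
    {E : Set ℕ} (hE : IsThin E) : IsThin {n | composition L n ∈ E} := by
  induction L generalizing E with
  | nil => exact hE
  | cons f L ih =>
    exact ih (E := {m | f m ∈ E}) (fun g hg => hL g (List.mem_cons_of_mem _ hg))
      ((hL f List.mem_cons_self).isThin_preimage hE)

/-- With `m` the value of the inner composition, a failure forces `f m < √m`, a thin condition
pulled back to `n`, or `m` too small, which is the inductive case. -/
theorem isThin_composition_lt_rpow {L : List (ℕ → ℕ)} (hL : ∀ f ∈ L, PrimePowerControlled f) :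
    IsThin {n : ℕ | (composition L n : ℝ) < (n : ℝ) ^ ((1 : ℝ) / (2 : ℝ) ^ L.length)} := by
  induction L with
  | nil => exact isThin_empty.mono fun n _ hn => by simp [composition] at hn
  | cons f L ih =>
    have hL' : ∀ g ∈ L, PrimePowerControlled g := fun g hg => hL g (List.mem_cons_of_mem _ hg)
    refine ((isThin_composition_preimage hL' (hL f List.mem_cons_self).isThin_lt_sqrt).union
      (ih hL')).mono fun n _ hn => ?_
    by_contra hcon
    simp only [Set.mem_union, Set.mem_ofPred_eq, not_or, not_lt] at hcon hn
    refine not_le.2 hn ?_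
    rw [composition_cons]
    refine le_trans (le_of_eq ?_) ((Real.sqrt_le_sqrt hcon.2).trans hcon.1)
    rw [Real.sqrt_eq_rpow, ← Real.rpow_mul n.cast_nonneg, List.length_cons, pow_succ]
    congr 1
    field_simp

theorem lemma4p2 (j : ℕ) (hj : 1 ≤ j) (L : List (ℕ → ℕ)) (hlen : L.length = j)
    (hL : ∀ f ∈ L, f ∈ basicFunctions) :
    IsThin {n : ℕ | 1 ≤ n ∧ (composition L n : ℝ) < (n : ℝ) ^ ((1 : ℝ) / (2 : ℝ) ^ j)} := by
  subst hlen
  exact (isThin_composition_lt_rpow fun f hf =>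
    primePowerControlled_of_mem_basicFunctions (hL f hf)).mono fun n _ hn => hn.2
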